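/- Let $d\ge 1$ and let $\mathbb S^d=\{z\in\mathbb R^{d+1}:\langle z,z\rangle=1\}$ be equipped with the great circle metric $d_{\mathbb S^d}(x,y)=\arccos\langle x,y\rangle$. For $r\in[0,\pi]$ and $x\in\mathbb S^d$ let $B_r(x)=\{z\in\mathbb S^d: d_{\mathbb S^d}(x,z)\le r\}$ be the closed spherical cap with centre $x$ and radius $r$. Let $X$ be a random variable uniformly distributed on $\mathbb S^d$ (that is, according to the normalized surface measure), let $R$ be a random variable with values in $[0,\pi]$ that is independent of $X$, and let $B=B_R(X)$. Let $Q\in\mathbb N_0$ and let $p_0,\dots,p_Q\ge 0$ with $\sum_{q=0}^Q p_q=\frac12$. Assume that $\cos R$ has the distribution function $$F_Q(t)=\Bigl(\frac12+\sum_{q=0}^Q p_q t^{2q+1}\Bigr)\mathbf 1_{[-1,1]}(t)+\mathbf 1_{(1,\infty)}(t),\qquad t\in\mathbb R.$$ Then for all $x,y\in\mathbb S^d$, with $d_{xy}=d_{\mathbb S^d}(x,y)$, $$P(x,y\in B)=\frac12-\sum_{q=0}^Q\sum_{l=1}^{q+1}p_q\,C_{q,l,d}\,\sin^{2l-1}\Bigl(\frac{d_{xy}}2\Bigr)\cos^{2(q-l+1)}\Bigl(\frac{d_{xy}}2\Bigr),$$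 where $$C_{q,l,d}=2^{-(2q+1)}\,\frac{\Gamma(2q+2)\,\Gamma\bigl(\frac{d+1}2\bigr)}{\Gamma\bigl(\frac{2l+1}2\bigr)\,\Gamma(q-l+2)\,\Gamma\bigl(\frac{2q+d+2}2\bigr)}$$ and $0^0=1$. -/

import Mathlib

open MeasureTheory ProbabilityTheory

noncomputable section

namespace SphericalCaps

/-- The `d`-dimensional unit sphere in `ℝ^(d+1)`. -/
abbrev UnitSphere (d : ℕ) : Type :=
  Metric.sphere (0 : EuclideanSpace ℝ (Fin (d + 1))) 1

/-- The great circle metric on the unit sphere. -/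
def geodesicDist {d : ℕ} (x y : UnitSphere d) : ℝ :=
  Real.arccos (inner ℝ (x : EuclideanSpace ℝ (Fin (d + 1))) (y : EuclideanSpace ℝ (Fin (d + 1))))

/-- The closed spherical cap with radius `r` centred at `x`. -/
def cap {d : ℕ} (r : ℝ) (x : UnitSphere d) : Set (UnitSphere d) :=
  {z | geodesicDist x z ≤ r}

/-- The surface measure on the unit sphere, induced by Lebesgue measure. -/
def surfaceMeasure (d : ℕ) : Measure (UnitSphere d) :=
  (volume : Measure (EuclideanSpace ℝ (Fin (d + 1)))).toSphere

/-- The uniform probability measure on the unit sphere. -/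
def uniformMeasure (d : ℕ) : Measure (UnitSphere d) :=
  (surfaceMeasure d Set.univ)⁻¹ • surfaceMeasure d

/-- The function equal to `0` for `t < -1`, to `1/2 + ∑ q ≤ Q, p_q t^(2q+1)` on `[-1, 1]`,
and to `1` for `t > 1`. -/
def distFun (Q : ℕ) (p : ℕ → ℝ) (t : ℝ) : ℝ :=
  Set.indicator (Set.Icc (-1) 1)
      (fun s => 1 / 2 + ∑ q ∈ Finset.range (Q + 1), p q * s ^ (2 * q + 1)) t
    + Set.indicator (Set.Ioi 1) (fun _ => 1) t

/-- The constants `C_{q,l,d}`, used for `1 ≤ l ≤ q + 1` and `1 ≤ d`. -/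
def coeff (q l d : ℕ) : ℝ :=
  (1 / 2 ^ (2 * q + 1)) *
    (Real.Gamma (2 * (q : ℝ) + 2) * Real.Gamma (((d : ℝ) + 1) / 2) /
      (Real.Gamma ((2 * (l : ℝ) + 1) / 2) * Real.Gamma ((q : ℝ) - (l : ℝ) + 2) *
        Real.Gamma ((2 * (q : ℝ) + (d : ℝ) + 2) / 2)))

end SphericalCaps

end

namespace SphericalCaps

open Set Module

/-! Since `cos` decreases on `[0, π]`, both points lie in the cap iff `cos R ≤ min ⟨X,x⟩ ⟨X,y⟩`, so
by independence the probability is the mean of `F_Q` at this minimum. The vectors `x + y` and `x -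
y` are orthogonal, of norms `2c` and `2s` with `c = cos (d_xy / 2)`, `s = sin (d_xy / 2)`. If `U`,
`V` are the coordinates of `X` along them, the minimum is `c U - s |V|`
(`exists_orthonormalBasis_min_inner`).

As `F_Q` is a polynomial on `[-1, 1]`, only odd moments of `c U - s |V|` are needed. In the binomial
expansion odd powers of `U` integrate to zero. The other mixed moments come from evaluating one
Gaussian integral both in polar and in Cartesian coordinates (`integral_uniformMeasure_repr_pow`),
and `coeff_eq` matches the resulting Gamma quotients with `C_{q,l,d}`. -/

/-- Polar coordinates for a positively homogeneous function against a Gaussian weight. -/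
theorem integral_homogeneous_mul_exp_neg_norm_sq {E : Type*} [NormedAddCommGroup E]
    [NormedSpace ℝ E] [FiniteDimensional ℝ E] [Nontrivial E] [MeasurableSpace E] [BorelSpace E]
    (μ : Measure E) [μ.IsAddHaarMeasure] (f : E → ℝ) (k : ℕ)
    (hf : ∀ r : ℝ, 0 < r → ∀ z, f (r • z) = r ^ k * f z) :
    ∫ z, f z * Real.exp (-‖z‖ ^ 2) ∂μ =
      (∫ z, f z ∂μ.toSphere) * (Real.Gamma ((finrank ℝ E + k : ℝ) / 2) / 2) := by
  have hrad : ∫ r : Ioi (0 : ℝ), (r : ℝ) ^ k * Real.exp (-(r : ℝ) ^ 2)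
      ∂(Measure.volumeIoiPow (finrank ℝ E - 1)) =
      Real.Gamma ((finrank ℝ E + k : ℝ) / 2) / 2 := by
    simp only [Measure.volumeIoiPow, ENNReal.ofReal]
    rw [integral_withDensity_eq_integral_smul,
      integral_subtype_comap measurableSet_Ioi
        fun a ↦ Real.toNNReal (a ^ (finrank ℝ E - 1)) • (a ^ k * Real.exp (-a ^ 2))]
    · have h := integral_rpow_mul_exp_neg_rpow (p := 2) (q := (finrank ℝ E - 1 + k : ℕ))
        two_pos (lt_of_lt_of_le (by norm_num) (Nat.cast_nonneg _))
      have hn : 1 ≤ finrank ℝ E := finrank_pos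
      have hc : ((finrank ℝ E - 1 + k : ℕ) : ℝ) + 1 = finrank ℝ E + k := by
        push_cast [Nat.cast_sub hn]; ring
      rw [hc] at h
      rw [div_eq_inv_mul, ← one_div, ← h]
      refine setIntegral_congr_fun measurableSet_Ioi fun x hx ↦ ?_
      rw [NNReal.smul_def, Real.coe_toNNReal _ (pow_nonneg (le_of_lt hx) _), Real.rpow_natCast,
        pow_add, smul_eq_mul, mul_assoc]
      norm_num
    · exact (measurable_subtype_coe.pow_const _).real_toNNReal
  calc
    _ = ∫ z : ({(0)}ᶜ : Set E), f z * Real.exp (-‖(z : E)‖ ^ 2) ∂(μ.comap (↑)) := by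
      rw [integral_subtype_comap (measurableSet_singleton _).compl
        fun z ↦ f z * Real.exp (-‖z‖ ^ 2), restrict_compl_singleton]
    _ = ∫ w, f w.1 * ((w.2 : ℝ) ^ k * Real.exp (-(w.2 : ℝ) ^ 2))
          ∂μ.toSphere.prod (.volumeIoiPow (finrank ℝ E - 1)) := by
      rw [← μ.measurePreserving_homeomorphUnitSphereProd.integral_comp
        (Homeomorph.measurableEmbedding _)]
      refine integral_congr_ae (Filter.Eventually.of_forall fun z ↦ ?_)
      have hz : 0 < ‖(z : E)‖ := norm_pos_iff.2 z.2
      have := hf _ hz (‖(z : E)‖⁻¹ • (z : E))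
      rw [smul_inv_smul₀ hz.ne'] at this
      simp only [homeomorphUnitSphereProd_apply_snd_coe, homeomorphUnitSphereProd_apply_fst_coe]
      rw [this]
      ring
    _ = _ := by
      rw [← hrad]
      exact integral_prod_mul (fun z : Metric.sphere (0 : E) 1 ↦ f z)
        fun r : Ioi (0 : ℝ) ↦ (r : ℝ) ^ k * Real.exp (-(r : ℝ) ^ 2)

theorem integral_prod_repr {ι E : Type*} [Fintype ι] [NormedAddCommGroup E]
    [InnerProductSpace ℝ E] [FiniteDimensional ℝ E] [MeasurableSpace E] [BorelSpace E]
    (b : OrthonormalBasis ι ℝ E) (h : ι → ℝ → ℝ) :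
    ∫ z, ∏ i, h i (b.repr z i) = ∏ i, ∫ t, h i t := by
  rw [← integral_fintype_prod_volume_eq_prod h,
    ← (PiLp.volume_preserving_ofLp ι).integral_comp
      (MeasurableEquiv.toLp 2 (ι → ℝ)).symm.measurableEmbedding,
    ← b.measurePreserving_repr.integral_comp b.measurableEquiv.measurableEmbedding]

/-! ### Gaussian moments and moments on the sphere -/

theorem integral_abs_pow_mul_exp_neg_sq (n : ℕ) :
    ∫ t : ℝ, |t| ^ n * Real.exp (-t ^ 2) = Real.Gamma ((n + 1 : ℝ) / 2) := by
  have h := integral_comp_abs (f := fun t ↦ t ^ n * Real.exp (-t ^ 2))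
  have h' := integral_rpow_mul_exp_neg_rpow (p := 2) (q := n) two_pos
    (lt_of_lt_of_le (by norm_num) (Nat.cast_nonneg _))
  simp only [sq_abs, Real.rpow_natCast, Real.rpow_two] at h h'
  rw [h, h']
  ring

theorem integral_even_pow_mul_exp_neg_sq {n : ℕ} (hn : Even n) :
    ∫ t : ℝ, t ^ n * Real.exp (-t ^ 2) = Real.Gamma ((n + 1 : ℝ) / 2) := by
  simp only [← integral_abs_pow_mul_exp_neg_sq, hn.pow_abs]

theorem integral_odd_pow_mul_exp_neg_sq {n : ℕ} (hn : Odd n) :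
    ∫ t : ℝ, t ^ n * Real.exp (-t ^ 2) = 0 := by
  have h := integral_neg_eq_self (fun t : ℝ ↦ t ^ n * Real.exp (-t ^ 2)) volume
  simp only [hn.neg_pow, neg_sq, neg_mul, integral_neg] at h
  linarith

theorem integral_exp_neg_sq : ∫ t : ℝ, Real.exp (-t ^ 2) = √Real.pi := by
  simpa using integral_gaussian 1

variable {m : ℕ}

/-- Gaussian moments of two coordinates in an orthonormal basis. -/
theorem integral_repr_pow_mul_exp_neg_norm_sq
    (b : OrthonormalBasis (Fin (m + 2)) ℝ (EuclideanSpace ℝ (Fin (m + 2)))) (k j : ℕ) :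
    ∫ z, (b.repr z 0 ^ k * |b.repr z 1| ^ j) * Real.exp (-‖z‖ ^ 2) =
      (∫ t : ℝ, t ^ k * Real.exp (-t ^ 2)) * Real.Gamma ((j + 1 : ℝ) / 2) * √Real.pi ^ m := by
  have h := integral_prod_repr b (Fin.cons (fun t ↦ t ^ k * Real.exp (-t ^ 2))
    (Fin.cons (fun t ↦ |t| ^ j * Real.exp (-t ^ 2)) fun _ t ↦ Real.exp (-t ^ 2)))
  simp only [Fin.prod_univ_succ, Fin.cons_zero, Fin.cons_succ, integral_abs_pow_mul_exp_neg_sq,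
    integral_exp_neg_sq, Finset.prod_const, Finset.card_univ, Fintype.card_fin] at h
  rw [mul_assoc, ← h]
  congr 1 with z
  rw [← b.repr.norm_map z, EuclideanSpace.norm_sq_eq]
  simp only [Fin.sum_univ_succ, Real.norm_eq_abs, sq_abs, neg_add, Real.exp_add,
    ← Finset.sum_neg_distrib, Real.exp_sum, Fin.succ_zero_eq_one]
  ring

theorem integral_sphere_repr_pow
    (b : OrthonormalBasis (Fin (m + 2)) ℝ (EuclideanSpace ℝ (Fin (m + 2)))) (k j : ℕ) :
    (∫ z : UnitSphere (m + 1), b.repr z 0 ^ k * |b.repr z 1| ^ j ∂surfaceMeasure (m + 1)) *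
        (Real.Gamma ((m + 2 + (k + j)) / 2) / 2) =
      (∫ t : ℝ, t ^ k * Real.exp (-t ^ 2)) * Real.Gamma ((j + 1 : ℝ) / 2) * √Real.pi ^ m := by
  rw [← integral_repr_pow_mul_exp_neg_norm_sq b k j]
  have h := integral_homogeneous_mul_exp_neg_norm_sq
    (volume : Measure (EuclideanSpace ℝ (Fin (m + 2))))
    (fun z ↦ b.repr z 0 ^ k * |b.repr z 1| ^ j) (k + j) fun r hr z ↦ by
      simp only [map_smul, PiLp.smul_apply, smul_eq_mul, abs_mul, abs_of_pos hr]
      ring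
  simp only [finrank_euclideanSpace_fin] at h
  rw [h]
  push_cast
  rfl

theorem integral_uniformMeasure (d : ℕ) (f : UnitSphere d → ℝ) :
    ∫ z, f z ∂uniformMeasure d =
      (∫ z, f z ∂surfaceMeasure d) / ∫ _, (1 : ℝ) ∂surfaceMeasure d := by
  rw [uniformMeasure, integral_smul_measure, ENNReal.toReal_inv, integral_const]
  simp [Measure.real, div_eq_inv_mul]

/-- Mixed moments of two coordinates of a uniform point on the sphere. -/
theorem integral_uniformMeasure_repr_pow
    (b : OrthonormalBasis (Fin (m + 2)) ℝ (EuclideanSpace ℝ (Fin (m + 2)))) (k j : ℕ) :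
    ∫ z : UnitSphere (m + 1), b.repr z 0 ^ k * |b.repr z 1| ^ j ∂uniformMeasure (m + 1) =
      (∫ t : ℝ, t ^ k * Real.exp (-t ^ 2)) * Real.Gamma ((j + 1 : ℝ) / 2) *
        Real.Gamma ((m + 2) / 2) / (Real.pi * Real.Gamma ((m + 2 + (k + j)) / 2)) := by
  have h := integral_sphere_repr_pow b k j
  -- The zeroth moment gives the total surface measure, by which the uniform measure is normalized.
  have h0 := integral_sphere_repr_pow b 0 0
  simp only [pow_zero, mul_one, one_mul, integral_exp_neg_sq, Nat.cast_zero, zero_add, add_zero,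
    Real.Gamma_one_half_eq, Real.mul_self_sqrt Real.pi_pos.le] at h0
  have hG : 0 < Real.Gamma ((m + 2 + (k + j) : ℝ) / 2) := Real.Gamma_pos_of_pos (by positivity)
  have hG0 : 0 < Real.Gamma ((m + 2 : ℝ) / 2) := Real.Gamma_pos_of_pos (by positivity)
  have hp : 0 < √Real.pi ^ m := pow_pos (Real.sqrt_pos.2 Real.pi_pos) _
  have hS : (∫ _ : UnitSphere (m + 1), (1 : ℝ) ∂surfaceMeasure (m + 1)) ≠ 0 := by
    intro hS
    rw [hS, zero_mul] at h0
    exact (mul_pos Real.pi_pos hp).ne h0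
  rw [integral_uniformMeasure, div_eq_div_iff hS (mul_pos Real.pi_pos hG).ne']
  refine mul_right_cancel₀ hp.ne' ?_
  linear_combination (2 * Real.pi * √Real.pi ^ m) * h - 2 * (∫ t : ℝ, t ^ k * Real.exp (-t ^ 2)) *
    Real.Gamma ((j + 1 : ℝ) / 2) * √Real.pi ^ m * h0

/-! ### Coordinates adapted to two points -/

/-- Two orthogonal vectors are nonnegative multiples of the first two vectors of some
orthonormal basis. -/
theorem exists_orthonormalBasis_of_inner_eq_zero (u v : EuclideanSpace ℝ (Fin (m + 2)))
    (huv : inner ℝ u v = 0) :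
    ∃ b : OrthonormalBasis (Fin (m + 2)) ℝ (EuclideanSpace ℝ (Fin (m + 2))),
      u = ‖u‖ • b 0 ∧ v = ‖v‖ • b 1 := by
  classical
  -- Only the nonzero entries of `w` are extended to a basis, so `u = 0` or `v = 0` (the cases `y =
  -- -x` and `y = x`) needs no separate treatment.
  let w : Fin (m + 2) → EuclideanSpace ℝ (Fin (m + 2)) :=
    Fin.cons (‖u‖⁻¹ • u) (Fin.cons (‖v‖⁻¹ • v) fun _ ↦ 0)
  have hw0 : w 0 = ‖u‖⁻¹ • u := rfl
  have hw1 : w 1 = ‖v‖⁻¹ • v := rfl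
  have hw (i : Fin (m + 2)) (hi : w i ≠ 0) : (i = 0 ∧ u ≠ 0) ∨ (i = 1 ∧ v ≠ 0) := by
    refine Fin.cases (fun h ↦ ?_) (fun i ↦ Fin.cases (fun h ↦ ?_) (fun i h ↦ ?_) i) i hi
    · exact .inl ⟨rfl, fun h0 ↦ h (by simp [hw0, h0])⟩
    · exact .inr ⟨rfl, fun h0 ↦ h (by change w 1 = 0; simp [hw1, h0])⟩
    · exact absurd rfl h
  have hvu : inner ℝ v u = 0 := by rw [real_inner_comm, huv]
  have ho : Orthonormal ℝ ({i | w i ≠ 0}.domRestrict w) := by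
    constructor
    · rintro ⟨i, hi⟩
      rcases hw i hi with ⟨rfl, h⟩ | ⟨rfl, h⟩
      · exact norm_smul_inv_norm h
      · exact norm_smul_inv_norm h
    · rintro ⟨i, hi⟩ ⟨j, hj⟩ hij
      rcases hw i hi with ⟨rfl, h⟩ | ⟨rfl, h⟩ <;> rcases hw j hj with ⟨rfl, h'⟩ | ⟨rfl, h'⟩
      · exact absurd rfl hij
      · change inner ℝ (‖u‖⁻¹ • u) (‖v‖⁻¹ • v) = 0
        rw [inner_smul_left, inner_smul_right, huv, mul_zero, mul_zero]
      · change inner ℝ (‖v‖⁻¹ • v) (‖u‖⁻¹ • u) = 0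
        rw [inner_smul_left, inner_smul_right, hvu, mul_zero, mul_zero]
      · exact absurd rfl hij
  obtain ⟨b, hb⟩ := ho.exists_orthonormalBasis_extension_of_card_eq (by simp)
  refine ⟨b, ?_, ?_⟩
  · rcases eq_or_ne u 0 with h | h
    · simp [h]
    · rw [hb 0 (by simp [hw0, h]), hw0, smul_inv_smul₀ (norm_ne_zero_iff.2 h)]
  · rcases eq_or_ne v 0 with h | h
    · simp [h]
    · rw [hb 1 (by simp [hw1, h]), hw1, smul_inv_smul₀ (norm_ne_zero_iff.2 h)]

theorem inner_mem_Icc {d : ℕ} (x y : UnitSphere d) :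
    inner ℝ (x : EuclideanSpace ℝ (Fin (d + 1))) (y : EuclideanSpace ℝ (Fin (d + 1))) ∈
      Icc (-1 : ℝ) 1 := by
  have h := abs_real_inner_le_norm (x : EuclideanSpace ℝ (Fin (d + 1)))
    (y : EuclideanSpace ℝ (Fin (d + 1)))
  rw [norm_eq_of_mem_sphere, norm_eq_of_mem_sphere, mul_one] at h
  exact abs_le.1 h

theorem cos_geodesicDist {d : ℕ} (x y : UnitSphere d) :
    Real.cos (geodesicDist x y) =
      inner ℝ (x : EuclideanSpace ℝ (Fin (d + 1))) (y : EuclideanSpace ℝ (Fin (d + 1))) :=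
  Real.cos_arccos (inner_mem_Icc x y).1 (inner_mem_Icc x y).2

theorem mem_cap_iff {d : ℕ} {r : ℝ} (hr : r ∈ Icc 0 Real.pi) (x z : UnitSphere d) :
    z ∈ cap r x ↔ Real.cos r ≤
      inner ℝ (x : EuclideanSpace ℝ (Fin (d + 1))) (z : EuclideanSpace ℝ (Fin (d + 1))) := by
  rw [← cos_geodesicDist]
  exact (Real.strictAntiOn_cos.le_iff_ge hr
    (b := geodesicDist x z) ⟨Real.arccos_nonneg _, Real.arccos_le_pi _⟩).symm

/-- The smaller of the inner products with two points of the sphere, in coordinates adapted to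
the two points. -/
theorem exists_orthonormalBasis_min_inner (x y : UnitSphere (m + 1)) :
    ∃ b : OrthonormalBasis (Fin (m + 2)) ℝ (EuclideanSpace ℝ (Fin (m + 2))),
      ∀ z : EuclideanSpace ℝ (Fin (m + 2)),
        min (inner ℝ z (x : EuclideanSpace ℝ (Fin (m + 2))))
            (inner ℝ z (y : EuclideanSpace ℝ (Fin (m + 2)))) =
          -(Real.sin (geodesicDist x y / 2) * |b.repr z 1|) +
            Real.cos (geodesicDist x y / 2) * b.repr z 0 := by
  have hx : ‖(x : EuclideanSpace ℝ (Fin (m + 2)))‖ = 1 := norm_eq_of_mem_sphere x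
  have hy : ‖(y : EuclideanSpace ℝ (Fin (m + 2)))‖ = 1 := norm_eq_of_mem_sphere y
  have hcos := cos_geodesicDist x y
  have h0 : 0 ≤ geodesicDist x y := Real.arccos_nonneg _
  have hpi : geodesicDist x y ≤ Real.pi := Real.arccos_le_pi _
  set θ := geodesicDist x y
  have hc : 0 ≤ Real.cos (θ / 2) := Real.cos_nonneg_of_mem_Icc ⟨by linarith, by linarith⟩
  have hs : 0 ≤ Real.sin (θ / 2) := Real.sin_nonneg_of_nonneg_of_le_pi (by linarith) (by linarith)
  have hdouble : Real.cos θ = 2 * Real.cos (θ / 2) ^ 2 - 1 := by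
    rw [← Real.cos_two_mul]; ring_nf
  have hsq := Real.sin_sq_add_cos_sq (θ / 2)
  have hu : ‖(x + y : EuclideanSpace ℝ (Fin (m + 2)))‖ = 2 * Real.cos (θ / 2) := by
    rw [← sq_eq_sq₀ (norm_nonneg _) (by positivity), norm_add_sq_real, hx, hy, ← hcos]
    linarith
  have hv : ‖(x - y : EuclideanSpace ℝ (Fin (m + 2)))‖ = 2 * Real.sin (θ / 2) := by
    rw [← sq_eq_sq₀ (norm_nonneg _) (by positivity), norm_sub_sq_real, hx, hy, ← hcos]
    linarith
  obtain ⟨b, hb0, hb1⟩ := exists_orthonormalBasis_of_inner_eq_zero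
    (x + y : EuclideanSpace ℝ (Fin (m + 2))) (x - y)
    ((real_inner_add_sub_eq_zero_iff _ _).2 (hx.trans hy.symm))
  refine ⟨b, fun z ↦ ?_⟩
  have h1 := congrArg (inner ℝ z) hb0
  have h2 := congrArg (inner ℝ z) hb1
  rw [inner_add_right, inner_smul_right, hu, real_inner_comm (b 0), ← b.repr_apply_apply] at h1
  rw [inner_sub_right, inner_smul_right, hv, real_inner_comm (b 1), ← b.repr_apply_apply] at h2
  -- `min a b = (a + b - |a - b|) / 2`, with `a + b = 2cU` and `|a - b| = 2s|V|`.
  have h2' := congrArg (|·|) h2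
  simp only [abs_mul, abs_of_nonneg hs, abs_two] at h2'
  rcases le_total (inner ℝ z (x : EuclideanSpace ℝ (Fin (m + 2))))
    (inner ℝ z (y : EuclideanSpace ℝ (Fin (m + 2)))) with h | h
  · rw [abs_of_nonpos (sub_nonpos.2 h)] at h2'
    rw [min_eq_left h]
    linarith
  · rw [abs_of_nonneg (sub_nonneg.2 h)] at h2'
    rw [min_eq_right h]
    linarith

/-! ### The constants and the odd moments -/

theorem coeff_eq {q i : ℕ} (hi : i ≤ q) :
    ((2 * q + 1).choose (2 * i + 1) : ℝ) *
      (Real.Gamma (((2 * (q - i) : ℕ) + 1 : ℝ) / 2) * Real.Gamma (((2 * i + 1 : ℕ) + 1 : ℝ) / 2) *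
        Real.Gamma ((m + 2) / 2) /
          (Real.pi * Real.Gamma ((m + 2 + ((2 * (q - i) : ℕ) + (2 * i + 1 : ℕ))) / 2))) =
      coeff q (i + 1) (m + 1) := by
  obtain ⟨n, rfl⟩ := Nat.exists_eq_add_of_le hi
  have e : i + n - i = n := by omega
  rw [e, coeff]
  -- Legendre duplication at `i + 1` and `n + 1/2` produces `(2i+1)!` and `(2n)!`, which cancel
  -- against the binomial coefficient; the two factors `√π` cancel `π`.
  have h1 := Real.Gamma_mul_Gamma_add_half ((i : ℝ) + 1)
  have h2 := Real.Gamma_mul_Gamma_add_half ((n : ℝ) + 1 / 2)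
  have hn : 0 < Real.Gamma ((n : ℝ) + 1) := Real.Gamma_pos_of_pos (by positivity)
  have hi' : 0 < Real.Gamma ((i : ℝ) + 1 + 1 / 2) := Real.Gamma_pos_of_pos (by positivity)
  have hG : 0 < Real.Gamma ((m + 2 + (2 * n + (2 * i + 1)) : ℝ) / 2) :=
    Real.Gamma_pos_of_pos (by positivity)
  have r1 : (2 : ℝ) ^ (1 - 2 * ((i : ℝ) + 1)) = ((2 : ℝ) ^ (2 * i + 1))⁻¹ := by
    rw [← Real.rpow_natCast, ← Real.rpow_neg two_pos.le]
    push_cast; ring_nf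
  have r2 : (2 : ℝ) ^ (1 - 2 * ((n : ℝ) + 1 / 2)) = ((2 : ℝ) ^ (2 * n))⁻¹ := by
    rw [← Real.rpow_natCast, ← Real.rpow_neg two_pos.le]
    push_cast; ring_nf
  have g1 : Real.Gamma (2 * ((i : ℝ) + 1)) = (2 * i + 1).factorial := by
    rw [← Real.Gamma_nat_eq_factorial]; push_cast; ring_nf
  have g2 : Real.Gamma (2 * ((n : ℝ) + 1 / 2)) = (2 * n).factorial := by
    rw [← Real.Gamma_nat_eq_factorial]; push_cast; ring_nf
  have g3 : Real.Gamma (2 * ((i + n : ℕ) : ℝ) + 2) = (2 * (i + n) + 1).factorial := by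
    rw [← Real.Gamma_nat_eq_factorial]; push_cast; ring_nf
  rw [r1, g1] at h1
  rw [r2, g2, add_assoc, add_halves] at h2
  have hch := Nat.choose_mul_factorial_mul_factorial (n := 2 * (i + n) + 1) (k := 2 * i + 1)
    (by omega)
  rw [show 2 * (i + n) + 1 - (2 * i + 1) = 2 * n by omega] at hch
  rw [g3, ← hch]
  push_cast
  rw [show ((2 * (n : ℝ) + 1) / 2) = n + 1 / 2 by ring,
    show ((2 * (i : ℝ) + 1 + 1) / 2) = i + 1 by ring,
    show ((2 * ((i : ℝ) + 1) + 1) / 2) = i + 1 + 1 / 2 by ring,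
    show ((i : ℝ) + n - (i + 1) + 2) = n + 1 by ring,
    show ((m : ℝ) + 1 + 1) = m + 2 by ring,
    show (2 * ((i : ℝ) + n) + (m + 1) + 2) = m + 2 + (2 * n + (2 * i + 1)) by ring]
  have e1 : Real.Gamma ((i : ℝ) + 1) =
      (2 * i + 1).factorial * ((2 : ℝ) ^ (2 * i + 1))⁻¹ * √Real.pi /
        Real.Gamma ((i : ℝ) + 1 + 1 / 2) := by rw [eq_div_iff hi'.ne', h1]
  have e2 : Real.Gamma ((n : ℝ) + 1 / 2) =
      (2 * n).factorial * ((2 : ℝ) ^ (2 * n))⁻¹ * √Real.pi /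
        Real.Gamma ((n : ℝ) + 1) := by rw [eq_div_iff hn.ne', h2]
  rw [e1, e2]
  have hpi := Real.pi_pos
  field_simp
  rw [Real.sq_sqrt hpi.le]
  ring

theorem sum_range_two_mul {M : Type*} [AddCommMonoid M] (f : ℕ → M) (n : ℕ) :
    ∑ j ∈ Finset.range (2 * n), f j = ∑ i ∈ Finset.range n, (f (2 * i) + f (2 * i + 1)) := by
  induction n with
  | zero => simp
  | succ n ih => rw [mul_add, mul_one, Finset.sum_range_succ, Finset.sum_range_succ,
      Finset.sum_range_succ, ih, add_assoc]

instance (d : ℕ) : IsProbabilityMeasure (uniformMeasure d) := by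
  have : surfaceMeasure d ≠ 0 := Measure.toSphere_ne_zero _
  have : IsFiniteMeasure (surfaceMeasure d) := by unfold surfaceMeasure; infer_instance
  constructor
  rw [uniformMeasure, Measure.smul_apply, smul_eq_mul]
  exact ENNReal.inv_mul_cancel (by simpa) (measure_ne_top _ _)

theorem integrable_uniformMeasure {d : ℕ} {f : UnitSphere d → ℝ} (hf : Continuous f) :
    Integrable f (uniformMeasure d) :=
  hf.integrable_of_hasCompactSupport (HasCompactSupport.of_compactSpace f)

/-- The odd moments of `c U - s |V|` for two coordinates `U`, `V` of a uniform point. -/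
theorem integral_uniformMeasure_odd_pow
    (b : OrthonormalBasis (Fin (m + 2)) ℝ (EuclideanSpace ℝ (Fin (m + 2)))) (s c : ℝ) (q : ℕ) :
    ∫ z : UnitSphere (m + 1), (-(s * |b.repr z 1|) + c * b.repr z 0) ^ (2 * q + 1)
        ∂uniformMeasure (m + 1) =
      -∑ l ∈ Finset.Icc 1 (q + 1),
        coeff q l (m + 1) * s ^ (2 * l - 1) * c ^ (2 * (q + 1 - l)) := by
  have hcont (k j : ℕ) : Continuous fun z : UnitSphere (m + 1) ↦
      b.repr z 0 ^ k * |b.repr z 1| ^ j := by fun_prop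
  have hterm (z : UnitSphere (m + 1)) (j : ℕ) :
      (-(s * |b.repr z 1|)) ^ j * (c * b.repr z 0) ^ (2 * q + 1 - j) *
        ((2 * q + 1).choose j : ℝ) =
      ((-s) ^ j * c ^ (2 * q + 1 - j) * (2 * q + 1).choose j) *
        (b.repr z 0 ^ (2 * q + 1 - j) * |b.repr z 1| ^ j) := by
    rw [← neg_mul, mul_pow, mul_pow]; ring
  simp_rw [add_pow, hterm]
  rw [integral_finsetSum _ fun j _ ↦ (integrable_uniformMeasure (hcont _ _)).const_mul _]
  simp_rw [integral_const_mul, integral_uniformMeasure_repr_pow]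
  -- Split by the parity of the exponent `j` of `|V|`: even `j` leaves an odd power of `U` and
  -- contributes zero, while `j = 2i + 1` is the term `l = i + 1`.
  rw [show 2 * q + 1 + 1 = 2 * (q + 1) by ring, sum_range_two_mul, Finset.range_eq_Ico,
    ← Finset.sum_neg_distrib, ← Finset.Ico_add_one_right_eq_Icc,
    show Finset.Ico 1 (q + 1 + 1) = Finset.Ico (0 + 1) (q + 1 + 1) from rfl,
    ← Finset.sum_Ico_add' _ 0 (q + 1) 1]
  refine Finset.sum_congr rfl fun i hi ↦ ?_
  have hi' : i ≤ q := by have := (Finset.mem_Ico.1 hi).2; omega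
  rw [integral_odd_pow_mul_exp_neg_sq ⟨q - i, by omega⟩,
    show 2 * q + 1 - (2 * i + 1) = 2 * (q - i) by omega,
    integral_even_pow_mul_exp_neg_sq (even_two_mul _), ← coeff_eq hi',
    (odd_two_mul_add_one i).neg_pow, show 2 * (i + 1) - 1 = 2 * i + 1 by omega,
    show q + 1 - (i + 1) = q - i by omega]
  ring

theorem distFun_eq {Q : ℕ} {p : ℕ → ℝ} {t : ℝ} (ht : t ∈ Icc (-1 : ℝ) 1) :
    distFun Q p t = 1 / 2 + ∑ q ∈ Finset.range (Q + 1), p q * t ^ (2 * q + 1) := by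
  rw [distFun, indicator_of_mem ht, indicator_of_notMem (notMem_Ioi.2 ht.2), add_zero]

/-- By Fubini: the slice over `z` is the half-line up to `f z`. -/
theorem measureReal_prod_le_eq_integral_cdf {α : Type*} [MeasurableSpace α] (μ : Measure α)
    [IsProbabilityMeasure μ] (ν : Measure ℝ) [IsProbabilityMeasure ν] {f : α → ℝ}
    (hf : Measurable f) :
    (μ.prod ν).real {w | w.2 ≤ f w.1} = ∫ z, cdf ν (f z) ∂μ := by
  have hs : MeasurableSet {w : α × ℝ | w.2 ≤ f w.1} :=
    measurableSet_le measurable_snd (hf.comp measurable_fst)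
  simp_rw [cdf_eq_real, measureReal_def]
  rw [Measure.prod_apply hs]
  exact (integral_toReal (measurable_measure_prodMk_left hs).aemeasurable
    (ae_of_all _ fun _ ↦ measure_lt_top _ _)).symm

/-- The probability that a random spherical cap contains two given points. -/
theorem measureReal_mem_cap_and_mem_cap {Ω : Type*} [MeasurableSpace Ω] (P : Measure Ω) [IsProbabilityMeasure P]
    (X : Ω → UnitSphere (m + 1)) (R : Ω → ℝ)
    (hX : Measurable X) (hR : Measurable R)
    (hX_unif : P.map X = uniformMeasure (m + 1))
    (hR_mem : ∀ ω, R ω ∈ Set.Icc 0 Real.pi)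
    (hXR : IndepFun X R P)
    (Q : ℕ) (p : ℕ → ℝ)
    (hcdf : ∀ t : ℝ, cdf (P.map fun ω => Real.cos (R ω)) t = distFun Q p t)
    (x y : UnitSphere (m + 1)) :
    P.real {ω | x ∈ cap (R ω) (X ω) ∧ y ∈ cap (R ω) (X ω)} =
      1 / 2 - ∑ q ∈ Finset.range (Q + 1), ∑ l ∈ Finset.Icc 1 (q + 1),
        p q * coeff q l (m + 1) *
          Real.sin (geodesicDist x y / 2) ^ (2 * l - 1) *
          Real.cos (geodesicDist x y / 2) ^ (2 * (q + 1 - l)) := by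
  obtain ⟨b, hb⟩ := exists_orthonormalBasis_min_inner x y
  set s := Real.sin (geodesicDist x y / 2)
  set c := Real.cos (geodesicDist x y / 2)
  let f : UnitSphere (m + 1) → ℝ := fun z ↦ -(s * |b.repr z 1|) + c * b.repr z 0
  have hf : Continuous f := by fun_prop
  have hfI (z : UnitSphere (m + 1)) : f z ∈ Set.Icc (-1 : ℝ) 1 := by
    change -(s * |b.repr z 1|) + c * b.repr z 0 ∈ _
    rw [← hb z]
    exact ⟨le_min (inner_mem_Icc z x).1 (inner_mem_Icc z y).1,
      (min_le_left _ _).trans (inner_mem_Icc z x).2⟩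
  have hcosR : Measurable fun ω ↦ Real.cos (R ω) := Real.measurable_cos.comp hR
  have hind : IndepFun X (fun ω ↦ Real.cos (R ω)) P :=
    hXR.comp measurable_id Real.measurable_cos
  have hset : {ω | x ∈ cap (R ω) (X ω) ∧ y ∈ cap (R ω) (X ω)} =
      (fun ω ↦ (X ω, Real.cos (R ω))) ⁻¹' {w | w.2 ≤ f w.1} := by
    ext ω
    simp only [Set.mem_ofPred_eq, Set.mem_preimage, mem_cap_iff (hR_mem ω), f]
    rw [← hb, le_min_iff]
  have : IsProbabilityMeasure (P.map fun ω ↦ Real.cos (R ω)) :=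
    Measure.isProbabilityMeasure_map hcosR.aemeasurable
  rw [hset, ← map_measureReal_apply (hX.prodMk hcosR)
      (measurableSet_le measurable_snd (hf.measurable.comp measurable_fst) :
        MeasurableSet {w : UnitSphere (m + 1) × ℝ | w.2 ≤ f w.1}),
    (indepFun_iff_map_prod_eq_prod_map_map hX.aemeasurable hcosR.aemeasurable).1 hind,
    hX_unif, measureReal_prod_le_eq_integral_cdf _ _ hf.measurable]
  simp_rw [hcdf, distFun_eq (hfI _)]
  have hint (q : ℕ) : Integrable (fun z ↦ p q * f z ^ (2 * q + 1)) (uniformMeasure (m + 1)) :=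
    integrable_uniformMeasure (by fun_prop)
  rw [integral_add (integrable_const _) (integrable_finsetSum _ fun q _ ↦ hint q),
    integral_finsetSum _ fun q _ ↦ hint q]
  simp only [integral_const, probReal_univ, one_smul, integral_const_mul, f,
    integral_uniformMeasure_odd_pow, sub_eq_add_neg, ← Finset.sum_neg_distrib, Finset.mul_sum,
    mul_neg, mul_assoc]

end SphericalCaps

theorem proposition2 {Ω : Type*} [MeasurableSpace Ω] (P : Measure Ω) [IsProbabilityMeasure P]
    (d : ℕ) (hd : 1 ≤ d)
    (X : Ω → SphericalCaps.UnitSphere d) (R : Ω → ℝ)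
    (hX : Measurable X) (hR : Measurable R)
    (hX_unif : P.map X = SphericalCaps.uniformMeasure d)
    (hR_mem : ∀ ω, R ω ∈ Set.Icc 0 Real.pi)
    (hXR : IndepFun X R P)
    (Q : ℕ) (p : ℕ → ℝ) (hp : ∀ q ≤ Q, 0 ≤ p q)
    (hp_sum : ∑ q ∈ Finset.range (Q + 1), p q = 1 / 2)
    (hcdf : ∀ t : ℝ, cdf (P.map fun ω => Real.cos (R ω)) t = SphericalCaps.distFun Q p t)
    (x y : SphericalCaps.UnitSphere d) :
    P.real {ω | x ∈ SphericalCaps.cap (R ω) (X ω) ∧ y ∈ SphericalCaps.cap (R ω) (X ω)} =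
      1 / 2 - ∑ q ∈ Finset.range (Q + 1), ∑ l ∈ Finset.Icc 1 (q + 1),
        p q * SphericalCaps.coeff q l d *
          Real.sin (SphericalCaps.geodesicDist x y / 2) ^ (2 * l - 1) *
          Real.cos (SphericalCaps.geodesicDist x y / 2) ^ (2 * (q + 1 - l)) := by
  obtain ⟨m, rfl⟩ := Nat.exists_eq_add_of_le' hd
  exact SphericalCaps.measureReal_mem_cap_and_mem_cap P X R hX hR hX_unif hR_mem hXR Q p hcdf x y
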